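/- Let $\mathcal{M}$ be a von Neumann algebra acting on an arbitrary complex Hilbert space. For a bounded unital algebra homomorphism $\rho:\mathcal{M}\to B(K)$ (not assumed $*$-preserving), $K$ a Hilbert space, let $\|\rho\|_{cb}=\sup_{n}\|\rho_n\|\in[0,\infty]$, where $\rho_n([a_{ij}])=[\rho(a_{ij})]$ on $\mathcal{M}_n(\mathcal{M})$. Let $\hat d_*(\mathcal{M})\in[0,\infty]$ be the smallest (more precisely, the infimum of all) positive $\gamma$ such that $$\|\rho\|_{cb}\le\gamma\,\|\rho\|^{\gamma}$$ for every Hilbert space $K$ and every bounded unital homomorphism $\rho:\mathcal{M}\to B(K)$ that is ultra$*$strong-ultra$*$strong continuous on the closed unit ball of $\mathcal{M}$ (with $\hat d_*(\mathcal{M})=\infty$ if there is no such $\gamma$). Here the ultra$*$strong topology on $B(H)$ is the locally convex topology given by the seminorms $x\mapsto(\sum_n\|x\xi_n\|^2)^{1/2}$ and $x\mapsto(\sum_n\|x^*\xi_n\|^2)^{1/2}$, where $\sum_n\|\xi_n\|^2<\infty$. If $\mathcal{M}$ is hyperfinite, i.e. $\mathcal{M}$ is the weak operator closure of the union of an upward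 directed family of finite-dimensional $*$-subalgebras containing the unit of $\mathcal{M}$, then $\hat d_*(\mathcal{M})\le 2$. -/

import Mathlib

open scoped ENNReal NNReal

noncomputable section

namespace HyperfiniteDegree

universe u v

variable {H : Type u} [NormedAddCommGroup H] [InnerProductSpace ℂ H] [CompleteSpace H]
variable {K : Type v} [NormedAddCommGroup K] [InnerProductSpace ℂ K] [CompleteSpace K]

/-- For a square-summable sequence `ξ` in `H`, the linear map `x ↦ (x ξₙ)ₙ` from `B(H)` to
`ℓ²(ℕ, H)`. -/
def evalSeq (ξ : lp (fun _ : ℕ => H) 2) : (H →L[ℂ] H) →ₗ[ℂ] lp (fun _ : ℕ => H) 2 where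
  toFun x := ⟨fun n => x (ξ n), by
    have h : Memℓp (fun n => ((‖x‖ : ℝ) : ℂ) • ξ n) 2 := (lp.memℓp ξ).const_smul _
    exact h.mono' fun n => by
      rw [norm_smul]
      simpa using x.le_opNorm (ξ n)⟩
  map_add' _ _ := rfl
  map_smul' _ _ := rfl

variable (H) in
/-- The ultra*strong (`σ`-strong*) topology on `B(H)`: the locally convex topology defined by the
seminorms `x ↦ (∑ₙ ‖x ξₙ‖²)^(1/2)` and `x ↦ (∑ₙ ‖x* ξₙ‖²)^(1/2)`, where `ξ` ranges over all
square-summable sequences in `H`. -/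
@[reducible] def ultraStarStrong : TopologicalSpace (H →L[ℂ] H) :=
  ⨅ ξ : lp (fun _ : ℕ => H) 2,
    TopologicalSpace.induced (fun x => evalSeq ξ x) inferInstance ⊓
      TopologicalSpace.induced (fun x => evalSeq ξ (star x)) inferInstance

/-- A map from a von Neumann algebra `M` on `H` to `B(K)` is ultra*strong-ultra*strong
continuous on the closed unit ball of `M`. -/
def IsUltraStarStrongContinuousOnBall (M : VonNeumannAlgebra H)
    (f : M.toStarSubalgebra → (K →L[ℂ] K)) : Prop :=
  @ContinuousOn M.toStarSubalgebra (K →L[ℂ] K)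
    ((ultraStarStrong H).induced Subtype.val) (ultraStarStrong K)
    f (Metric.closedBall 0 1)

/-- The completely bounded norm `sup_n ‖ρ_n‖ ∈ [0, ∞]` of a map `ρ : M → B(K)`, where
`ρ_n` is the entrywise application of `ρ` to `n × n` matrices over `M`. The norms are the
C⋆-norms of `Mₙ(B(H)) = B(Hⁿ)`, which contains `Mₙ(M)`, and of `Mₙ(B(K)) = B(Kⁿ)`. -/
def cbNorm (M : VonNeumannAlgebra H) (ρ : M.toStarSubalgebra → (K →L[ℂ] K)) : ℝ≥0∞ :=
  ⨆ (n : ℕ) (a : CStarMatrix (Fin n) (Fin n) M.toStarSubalgebra)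
    (_ : ‖(a.map Subtype.val : CStarMatrix (Fin n) (Fin n) (H →L[ℂ] H))‖ ≤ 1),
    ‖(a.map ρ : CStarMatrix (Fin n) (Fin n) (K →L[ℂ] K))‖ₑ

/-- The number `γ` satisfies `‖ρ‖_cb ≤ γ ‖ρ‖ ^ γ` for every Hilbert space `K` and every bounded
unital homomorphism `ρ : M → B(K)` (not necessarily `*`-preserving) which is
ultra*strong-ultra*strong continuous on the closed unit ball of `M`. -/
def IsDegreeBound (M : VonNeumannAlgebra H) (γ : ℝ≥0) : Prop :=
  ∀ (K : Type v) [NormedAddCommGroup K] [InnerProductSpace ℂ K] [CompleteSpace K]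
    (ρ : M.toStarSubalgebra →A[ℂ] (K →L[ℂ] K)),
    IsUltraStarStrongContinuousOnBall M ρ →
      cbNorm M ρ ≤ (γ : ℝ≥0∞) * ‖ρ.toContinuousLinearMap‖ₑ ^ (γ : ℝ)

/-- The modified similarity degree `d̂_*(M)` of a von Neumann algebra `M`: the smallest positive
number `γ` with `‖ρ‖_cb ≤ γ ‖ρ‖ ^ γ` for all `ρ` as above, and `∞` if there is none. -/
def modifiedSimilarityDegree (M : VonNeumannAlgebra H) : ℝ≥0∞ :=
  ⨅ (γ : ℝ≥0) (_ : 0 < γ ∧ IsDegreeBound.{u, v} M γ), (γ : ℝ≥0∞)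

/-- `M` is hyperfinite: it is the weak operator closure of the union of an upward directed family
of finite-dimensional unital `*`-subalgebras. -/
def IsHyperfinite (M : VonNeumannAlgebra H) : Prop :=
  ∃ 𝓕 : Set (StarSubalgebra ℂ (H →L[ℂ] H)),
    𝓕.Nonempty ∧ DirectedOn (· ≤ ·) 𝓕 ∧ (∀ A ∈ 𝓕, FiniteDimensional ℂ A) ∧
    ∀ x : H →L[ℂ] H, x ∈ M ↔
      ContinuousLinearMapWOT.ofCLM x ∈
        closure {y : H →WOT[ℂ] H | ∃ A ∈ 𝓕, y.toCLM ∈ A}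

end HyperfiniteDegree

end

noncomputable section

namespace HyperfiniteDegree

open Filter Topology MeasureTheory
open scoped InnerProductSpace

universe u v

/-! ### Averaging over unitary groups and weak limits of operators -/

section Averaging

variable {K : Type v} [NormedAddCommGroup K] [InnerProductSpace ℂ K] [CompleteSpace K]

/-! Write `C = ‖ρ‖`. On a finite-dimensional `*`-subalgebra the unitary group is compact, and the
Haar average `T` of `ρ(u)* ρ(u)` gives an inner product `⟪T x, y⟫` for which `ρ` is `*`-preserving,
with `C⁻² ≤ T ≤ C²` when `K ≠ 0`. These bounds do not depend on the subalgebra, so a weak limit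
along the directed family gives one `T` with `ρ(a)* T = T ρ(a*)` on the whole union
(`exists_form_of_directed`).

Passing to `M` is delicate because `ρ` is only continuous on the unit ball, while strong
approximants of an operator may be unbounded. In place of Kaplansky's density theorem, a
self-adjoint `c` is approximated strongly by self-adjoint `b` in the union. The resolvents of `b` at
`±i` are contractions, stay in the union and converge `*`-strongly. Hence the identity holds for `(i
- c)⁻¹`, then for its inverse, then for `c` (`exists_form_of_isHyperfinite`).

With `S = T^{1/2}`, the map `S ρ S⁻¹` is a `*`-homomorphism, hence completely contractive, so
`‖ρ‖_cb ≤ ‖S⁻¹‖ ‖S‖ ≤ C²` (`IsEquivalentForm.norm_map_le`). -/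

theorem norm_le_one_of_mem_unitary {A : Type*} [CStarAlgebra A] {u : A} (hu : u ∈ unitary A) :
    ‖u‖ ≤ 1 := by
  rcases subsingleton_or_nontrivial A with h | h
  · simp [Subsingleton.elim u 0]
  · exact (CStarRing.norm_of_mem_unitary hu).le

theorem compactSpace_unitary (A : Type*) [CStarAlgebra A] [FiniteDimensional ℂ A] :
    CompactSpace (unitary A) := by
  have : ProperSpace A := FiniteDimensional.proper ℂ A
  refine isCompact_iff_compactSpace.mp ?_
  refine Metric.isCompact_of_isClosed_isBounded isClosed_unitary ?_
  refine (Metric.isBounded_closedBall (x := (0 : A)) (r := 1)).subset fun u hu => ?_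
  rw [mem_closedBall_zero_iff]
  exact norm_le_one_of_mem_unitary hu

/-- The form `⟪T x, y⟫` is an inner product equivalent to the given one, with constants
controlled by `C`. -/
structure IsEquivalentForm (C : ℝ) (T : K →L[ℂ] K) : Prop where
  symm : ∀ x y, ⟪T x, y⟫_ℂ = ⟪x, T y⟫_ℂ
  lower : ∀ x, ‖x‖ ^ 2 ≤ C ^ 2 * RCLike.re ⟪T x, x⟫_ℂ
  norm_le : ‖T‖ ≤ C ^ 2

/-- A bounded homomorphism of a finite-dimensional C⋆-algebra into `B(K)` is `*`-preserving for an
equivalent inner product on `K`. -/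
theorem exists_form_of_finiteDimensional (A : Type*) [CStarAlgebra A]
    [FiniteDimensional ℂ A] (σ : A →ₐ[ℂ] (K →L[ℂ] K)) {C : ℝ} (hC0 : 0 ≤ C)
    (hC : ∀ a, ‖σ a‖ ≤ C * ‖a‖) :
    ∃ T : K →L[ℂ] K, IsEquivalentForm C T ∧
      ∀ a x y, ⟪T x, σ a y⟫_ℂ = ⟪T (σ (star a) x), y⟫_ℂ := by
  have := compactSpace_unitary A
  let _ : MeasurableSpace (unitary A) := borel _
  have : BorelSpace (unitary A) := ⟨rfl⟩
  let μ : Measure (unitary A) := Measure.haarMeasure ⊤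
  have : IsProbabilityMeasure μ := ⟨by
    simpa using! Measure.haarMeasure_self (K₀ := (⊤ : TopologicalSpace.PositiveCompacts (unitary A)))⟩
  have hσ : Continuous σ := AddMonoidHomClass.continuous_of_bound σ C hC
  have hU : ∀ u : unitary A, ‖σ u‖ ≤ C := fun u =>
    (hC u).trans (mul_le_of_le_one_right hC0 (norm_le_one_of_mem_unitary u.2))
  -- The inverse matches left invariance of Haar measure: `σ((vu)⁻¹) σ(v) = σ(u⁻¹)`.
  let F : unitary A → (K →L[ℂ] K) := fun u => star (σ (u⁻¹ : unitary A)) * σ (u⁻¹ : unitary A)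
  have hF : Continuous F := by
    have h1 : Continuous fun u : unitary A => σ (u⁻¹ : unitary A) :=
      hσ.comp (continuous_subtype_val.comp continuous_inv)
    exact h1.star.mul h1
  have hFi : Integrable F μ := hF.integrable_of_hasCompactSupport (HasCompactSupport.of_compactSpace _)
  have hFinner : ∀ u x y, ⟪F u x, y⟫_ℂ = ⟪σ (u⁻¹ : unitary A) x, σ (u⁻¹ : unitary A) y⟫_ℂ := by
    intro u x y
    simp [F, ContinuousLinearMap.star_eq_adjoint, ContinuousLinearMap.adjoint_inner_left]
  have hFx : ∀ x, Integrable (fun u => F u x) μ := fun x =>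
    (ContinuousLinearMap.apply ℂ K x).integrable_comp hFi
  let T : K →L[ℂ] K := ∫ u, F u ∂μ
  have hT : ∀ x y, ⟪T x, y⟫_ℂ = ∫ u, ⟪F u x, y⟫_ℂ ∂μ := by
    intro x y
    rw [← inner_conj_symm, ContinuousLinearMap.integral_apply hFi, ← integral_inner (hFx x) y,
      ← integral_conj]
    simp
  have hTU : ∀ (v : unitary A) x y, ⟪T (σ v x), σ v y⟫_ℂ = ⟪T x, y⟫_ℂ := by
    intro v x y
    rw [hT, hT, ← integral_mul_left_eq_self _ v]
    refine integral_congr_ae (.of_forall fun u => ?_)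
    have h : ∀ z, σ ((v * u)⁻¹ : unitary A) (σ v z) = σ (u⁻¹ : unitary A) z := fun z => by
      rw [← mul_apply_eq_comp, ← map_mul, ← Submonoid.coe_mul]
      congr 3
      group
    simp only [hFinner, h]
  -- For unitary `u` this is invariance applied to `σ(u*) x`. Both sides are linear in `a`, and
  -- unitaries span `A`.
  have hspan : ∀ a ∈ Submodule.span ℂ (unitary A : Set A),
      ∀ x y, ⟪T x, σ a y⟫_ℂ = ⟪T (σ (star a) x), y⟫_ℂ := by
    intro a ha
    induction ha using Submodule.span_induction with
    | mem u hu =>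
      intro x y
      have := hTU ⟨u, hu⟩ (σ (star u) x) y
      have h : σ u (σ (star u) x) = x := by
        rw [← mul_apply_eq_comp, ← map_mul, (Unitary.mem_iff.mp hu).2, map_one]
        rfl
      rw [← this, h]
    | zero => simp
    | add a b _ _ iha ihb => intro x y; simp [iha, ihb]
    | smul c a _ ih => intro x y; simp [ih, mul_comm]
  refine ⟨T, ⟨?_, ?_, ?_⟩, fun a => hspan a (by rw [CStarAlgebra.span_unitary]; trivial)⟩
  · intro x y
    rw [hT, ← inner_conj_symm x, hT, ← integral_conj]
    refine integral_congr_ae (.of_forall fun u => ?_)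
    simp only [hFinner, inner_conj_symm]
  · intro x
    have hre : RCLike.re ⟪T x, x⟫_ℂ = ∫ u : unitary A, ‖σ (u⁻¹ : unitary A) x‖ ^ 2 ∂μ := by
      rw [hT, ← integral_re]
      · refine integral_congr_ae (.of_forall fun u => ?_)
        simp only [hFinner, inner_self_eq_norm_sq]
      · exact (hFx x).inner_const x
    have hcont : Continuous fun u : unitary A => C ^ 2 * ‖σ (u⁻¹ : unitary A) x‖ ^ 2 := by
      have h1 : Continuous fun u : unitary A => σ (u⁻¹ : unitary A) :=
        hσ.comp (continuous_subtype_val.comp continuous_inv)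
      fun_prop
    rw [hre, ← integral_const_mul]
    calc ‖x‖ ^ 2 = ∫ _ : unitary A, ‖x‖ ^ 2 ∂μ := by simp
      _ ≤ _ := by
        refine integral_mono (integrable_const _)
          (hcont.integrable_of_hasCompactSupport (HasCompactSupport.of_compactSpace _)) fun u => ?_
        have h : x = σ u (σ (u⁻¹ : unitary A) x) := by
          rw [← mul_apply_eq_comp, ← map_mul, ← Submonoid.coe_mul]
          simp
        simp only
        rw [← mul_pow]
        gcongr
        calc ‖x‖ = ‖σ u (σ (u⁻¹ : unitary A) x)‖ := by rw [← h]
          _ ≤ _ := ContinuousLinearMap.le_of_opNorm_le _ (hU u) _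
  · refine (norm_integral_le_of_norm_le_const (C := C ^ 2) (.of_forall fun u => ?_)).trans ?_
    · rw [CStarRing.norm_star_mul_self, ← sq]
      gcongr
      exact hU _
    · simp

/-- Bounded families of operators converge weakly along ultrafilters. -/
theorem exists_weak_limit {ι : Type*} (𝒰 : Ultrafilter ι) (T : ι → (K →L[ℂ] K)) {D : ℝ}
    (hT : ∀ i, ‖T i‖ ≤ D) :
    ∃ S : K →L[ℂ] K, ‖S‖ ≤ D ∧ ∀ x y, Tendsto (fun i => ⟪T i x, y⟫_ℂ) 𝒰 (𝓝 ⟪S x, y⟫_ℂ) := by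
  have hD : 0 ≤ D := by
    obtain ⟨i⟩ := 𝒰.nonempty_of_neBot
    exact (norm_nonneg _).trans (hT i)
  have hb : ∀ x y i, ‖⟪T i x, y⟫_ℂ‖ ≤ D * ‖x‖ * ‖y‖ := fun x y i =>
    (norm_inner_le_norm _ _).trans (by gcongr; exact (T i).le_of_opNorm_le (hT i) x)
  -- The matrix coefficients stay in a compact disc, so they converge along the ultrafilter; the
  -- limits form a bounded sesquilinear form.
  have hlim : ∀ x y, ∃ c : ℂ, Tendsto (fun i => ⟪T i x, y⟫_ℂ) 𝒰 (𝓝 c) := by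
    intro x y
    obtain ⟨c, -, hc⟩ := (isCompact_closedBall (0 : ℂ) (D * ‖x‖ * ‖y‖)).ultrafilter_le_nhds'
      (𝒰.map fun i => ⟪T i x, y⟫_ℂ) (Filter.mem_map.mpr <| Filter.univ_mem' fun i => by simpa using hb x y i)
    exact ⟨c, hc⟩
  choose g hg using hlim
  let B : K →L⋆[ℂ] K →L[ℂ] ℂ := LinearMap.mkContinuous₂
    (LinearMap.mk₂'ₛₗ (starRingEnd ℂ) (RingHom.id ℂ) g
      (fun x x' y => tendsto_nhds_unique (hg _ _)
        (by simpa [inner_add_left] using (hg x y).add (hg x' y)))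
      (fun c x y => tendsto_nhds_unique (hg _ _)
        (by simpa [inner_smul_left, mul_comm] using (hg x y).const_mul (starRingEnd ℂ c)))
      (fun x y y' => tendsto_nhds_unique (hg _ _)
        (by simpa [inner_add_right] using (hg x y).add (hg x y')))
      (fun c x y => tendsto_nhds_unique (hg _ _)
        (by simpa [inner_smul_right] using (hg x y).const_mul c)))
    D (fun x y => le_of_tendsto (hg x y).norm (.of_forall (hb x y)))
  have hS : ∀ x y, ⟪InnerProductSpace.continuousLinearMapOfBilin B x, y⟫_ℂ = g x y := fun x y => by
    rw [InnerProductSpace.continuousLinearMapOfBilin_apply]; rfl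
  refine ⟨InnerProductSpace.continuousLinearMapOfBilin B, ?_, fun x y => by
    rw [hS]; exact hg x y⟩
  refine ContinuousLinearMap.opNorm_le_of_re_inner_le hD fun x y hx hy => ?_
  have h := le_of_tendsto (hg x y).norm (.of_forall (hb x y))
  rw [hx, hy, mul_one, mul_one] at h
  rw [hS]
  exact (Complex.re_le_norm _).trans h

end Averaging

/-! ### Weak versus strong closure of convex sets of operators -/

section Density

variable {H : Type u} [NormedAddCommGroup H] [InnerProductSpace ℂ H]

/-- A convex set of operators has the same closure for the weak and the strong operator
topologies. -/
theorem mem_closure_pi_of_mem_closure_wot {s : Set (H →L[ℂ] H)} (hs : Convex ℝ s) {c : H →L[ℂ] H}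
    (hc : ContinuousLinearMapWOT.ofCLM c ∈
      closure {y : H →WOT[ℂ] H | y.toCLM ∈ s}) :
    (c : H → H) ∈ closure ((fun b : H →L[ℂ] H => (b : H → H)) '' s) := by
  rw [mem_closure_iff]
  classical
  intro o ho hco
  obtain ⟨I, w, hw, hI⟩ := isOpen_pi_iff.mp ho _ hco
  -- A basic neighbourhood tests only finitely many vectors, so the claim reduces to Mazur's theorem
  -- in `I → H`: weak and norm closures of a convex set agree.
  let L : (H →L[ℂ] H) →ₗ[ℂ] (I → H) :=
    LinearMap.pi fun i => (ContinuousLinearMap.apply ℂ H (i : H)).toLinearMap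
  have hL : Continuous fun y : H →WOT[ℂ] H => toWeakSpace ℂ (I → H) (L y.toCLM) := by
    refine WeakBilin.continuous_of_continuous_eval _ fun f => ?_
    have : ∀ y : H →WOT[ℂ] H, f (L y.toCLM) =
        ∑ i : I, (f.comp (ContinuousLinearMap.single ℂ (fun _ : I => H) i)) (y i) := by
      intro y
      conv_lhs => rw [← Finset.univ_sum_single (L y.toCLM), map_sum]
      rfl
    refine Continuous.congr ?_ fun y => (this y).symm
    exact continuous_finsetSum _ fun i _ => ContinuousLinearMapWOT.continuous_dual_apply _ _
  have h1 : toWeakSpace ℂ (I → H) (L c) ∈ closure (toWeakSpace ℂ (I → H) '' (L '' s)) := by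
    exact map_mem_closure (f := fun y : H →WOT[ℂ] H => toWeakSpace ℂ (I → H) (L y.toCLM)) hL hc
      fun y hy => ⟨_, ⟨_, hy, rfl⟩, rfl⟩
  have hconv : Convex ℝ (L '' s) := hs.linear_image (L.restrictScalars ℝ)
  rw [← hconv.toWeakSpace_closure ℂ, (toWeakSpace ℂ (I → H)).injective.mem_set_image,
    mem_closure_iff] at h1
  obtain ⟨_, hb, b, hbs, rfl⟩ := h1 (Set.univ.pi fun i : I => w i)
    (isOpen_set_pi Set.finite_univ fun i _ => (hw i i.2).1) fun i _ => (hw i i.2).2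
  exact ⟨b, hI fun i hi => hb ⟨i, hi⟩ trivial, b, hbs, rfl⟩

variable [CompleteSpace H]

theorem continuous_star_wot :
    Continuous fun y : H →WOT[ℂ] H => ContinuousLinearMapWOT.ofCLM (star y.toCLM) := by
  refine ContinuousLinearMapWOT.continuous_of_dual_apply_continuous fun x f => ?_
  obtain ⟨z, rfl⟩ := (InnerProductSpace.toDual ℂ H).surjective f
  have : Continuous fun y : H →WOT[ℂ] H => starRingEnd ℂ (InnerProductSpace.toDual ℂ H x (y z)) :=
    Complex.continuous_conj.comp (ContinuousLinearMapWOT.continuous_dual_apply _ _)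
  refine this.congr fun y => ?_
  simp [ContinuousLinearMap.star_eq_adjoint, ContinuousLinearMap.adjoint_inner_right]

/-- A self-adjoint operator in the weak closure of a `*`-invariant subspace is a strong limit of
self-adjoint operators of that subspace. -/
theorem exists_filter_tendsto_of_isSelfAdjoint (V : Submodule ℂ (H →L[ℂ] H))
    (hV : ∀ b ∈ V, star b ∈ V) {c : H →L[ℂ] H} (hcs : IsSelfAdjoint c)
    (hc : ContinuousLinearMapWOT.ofCLM c ∈ closure {y : H →WOT[ℂ] H | y.toCLM ∈ V}) :
    ∃ l : Filter {b : H →L[ℂ] H // b ∈ V ∧ IsSelfAdjoint b}, l.NeBot ∧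
      ∀ x, Tendsto (fun b => b.1 x) l (𝓝 (c x)) := by
  let s : Set (H →L[ℂ] H) := {b | b ∈ V ∧ IsSelfAdjoint b}
  have hs : Convex ℝ s := by
    have h1 : Convex ℝ (V : Set (H →L[ℂ] H)) := (V.restrictScalars ℝ).convex
    have h2 : Convex ℝ {b : H →L[ℂ] H | IsSelfAdjoint b} :=
      (selfAdjoint.submodule ℝ (H →L[ℂ] H)).convex
    exact h1.inter h2
  -- Taking real parts is weakly continuous, maps `V` into `s` and fixes `c`.
  have hsym : Continuous fun y : H →WOT[ℂ] H =>
      (2⁻¹ : ℂ) • (y + ContinuousLinearMapWOT.ofCLM (star y.toCLM)) :=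
    (continuous_id.add continuous_star_wot).const_smul (2⁻¹ : ℂ)
  have hc' : ContinuousLinearMapWOT.ofCLM c ∈ closure {y : H →WOT[ℂ] H | y.toCLM ∈ s} := by
    have : ContinuousLinearMapWOT.ofCLM c = (2⁻¹ : ℂ) • (ContinuousLinearMapWOT.ofCLM c +
        ContinuousLinearMapWOT.ofCLM (star (ContinuousLinearMapWOT.ofCLM c).toCLM)) := by
      ext1 x
      simp only [hcs.star_eq]
      rw [← two_smul ℂ, smul_smul]
      simp
    rw [this]
    refine map_mem_closure (f := fun y : H →WOT[ℂ] H =>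
      (2⁻¹ : ℂ) • (y + ContinuousLinearMapWOT.ofCLM (star y.toCLM))) hsym hc fun y hy => ⟨?_, ?_⟩
    · exact V.smul_mem _ (V.add_mem hy (hV _ hy))
    · change star _ = _
      simp [add_comm]
  have h := mem_closure_pi_of_mem_closure_wot hs hc'
  refine ⟨comap (fun b : s => (b.1 : H → H)) (𝓝 (c : H → H)), ?_, fun x => ?_⟩
  · refine comap_neBot_iff.mpr fun t ht => ?_
    obtain ⟨_, hbt, b, hb, rfl⟩ := mem_closure_iff_nhds.mp h t ht
    exact ⟨⟨b, hb⟩, hbt⟩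
  · exact ((continuous_apply x).tendsto _).comp tendsto_comap

end Density

/-! ### Ultra*strong convergence on bounded sets -/

section UltraStarStrong

variable {H : Type u} [NormedAddCommGroup H] [InnerProductSpace ℂ H]

/-- Dominated convergence with majorant `(2‖ξₙ‖)²`; the uniform norm bound is what upgrades
pointwise to ultrastrong convergence. -/
theorem tendsto_evalSeq {ι : Type*} {l : Filter ι} {b : ι → H →L[ℂ] H} {c : H →L[ℂ] H}
    (hb : ∀ i, ‖b i‖ ≤ 1) (hc : ‖c‖ ≤ 1) (h : ∀ x, Tendsto (fun i => b i x) l (𝓝 (c x)))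
    (ξ : lp (fun _ : ℕ => H) 2) : Tendsto (fun i => evalSeq ξ (b i)) l (𝓝 (evalSeq ξ c)) := by
  rw [tendsto_iff_norm_sub_tendsto_zero]
  have hnorm : ∀ i, ‖evalSeq ξ (b i) - evalSeq ξ c‖ = Real.sqrt (∑' n, ‖b i (ξ n) - c (ξ n)‖ ^ 2) := by
    intro i
    rw [lp.norm_eq_tsum_rpow (by norm_num), Real.sqrt_eq_rpow]
    simp
    rfl
  simp only [hnorm]
  rw [← Real.sqrt_zero]
  refine (Real.continuous_sqrt.tendsto 0).comp ?_
  have hsum : Summable fun n => (2 * ‖ξ n‖) ^ 2 := by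
    have := (lp.memℓp ξ).summable (by norm_num)
    simp only [ENNReal.toReal_ofNat, Real.rpow_two] at this
    simpa [mul_pow] using this.mul_left (2 ^ 2)
  have := tendsto_tsum_of_dominated_convergence (𝓕 := l) (G := ℝ)
    (f := fun i n => ‖b i (ξ n) - c (ξ n)‖ ^ 2) (g := fun _ => 0) hsum ?_ ?_
  · simpa using this
  · intro n
    have h1 := (tendsto_iff_norm_sub_tendsto_zero.mp (h (ξ n))).pow 2
    simpa using h1
  · refine .of_forall fun i n => ?_
    rw [norm_pow, norm_norm]
    gcongr
    calc ‖b i (ξ n) - c (ξ n)‖ ≤ ‖b i (ξ n)‖ + ‖c (ξ n)‖ := norm_sub_le _ _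
      _ ≤ 1 * ‖ξ n‖ + 1 * ‖ξ n‖ := by
        gcongr
        · exact (b i).le_of_opNorm_le (hb i) _
        · exact c.le_of_opNorm_le hc _
      _ = _ := by ring

variable [CompleteSpace H]

theorem tendsto_ultraStarStrong_iff {ι : Type*} {l : Filter ι} {b : ι → H →L[ℂ] H}
    {c : H →L[ℂ] H} :
    Tendsto b l (@nhds _ (ultraStarStrong H) c) ↔ ∀ ξ : lp (fun _ : ℕ => H) 2,
      Tendsto (fun i => evalSeq ξ (b i)) l (𝓝 (evalSeq ξ c)) ∧
        Tendsto (fun i => evalSeq ξ (star (b i))) l (𝓝 (evalSeq ξ (star c))) := by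
  have h : @nhds _ (ultraStarStrong H) c = ⨅ ξ : lp (fun _ : ℕ => H) 2,
      comap (fun x : H →L[ℂ] H => evalSeq ξ x) (𝓝 (evalSeq ξ c)) ⊓
        comap (fun x : H →L[ℂ] H => evalSeq ξ (star x)) (𝓝 (evalSeq ξ (star c))) :=
    nhds_iInf.trans <| iInf_congr fun ξ => (@nhds_inf _ _ _ _).trans <|
      congrArg₂ (· ⊓ ·) (@nhds_induced _ _ _ (fun x : H →L[ℂ] H => evalSeq ξ x) c)
        (@nhds_induced _ _ _ (fun x : H →L[ℂ] H => evalSeq ξ (star x)) c)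
  rw [h, tendsto_iInf]
  refine forall_congr' fun ξ => ?_
  rw [tendsto_inf, tendsto_comap_iff, tendsto_comap_iff]
  rfl

theorem tendsto_ultraStarStrong {ι : Type*} {l : Filter ι} {b : ι → H →L[ℂ] H} {c : H →L[ℂ] H}
    (hb : ∀ i, ‖b i‖ ≤ 1) (hc : ‖c‖ ≤ 1) (h : ∀ x, Tendsto (fun i => b i x) l (𝓝 (c x)))
    (h' : ∀ x, Tendsto (fun i => star (b i) x) l (𝓝 (star c x))) :
    Tendsto b l (@nhds _ (ultraStarStrong H) c) :=
  tendsto_ultraStarStrong_iff.mpr fun ξ => ⟨tendsto_evalSeq hb hc h ξ,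
    tendsto_evalSeq (fun i => (norm_star _).trans_le (hb i)) ((norm_star _).trans_le hc) h' ξ⟩

theorem tendsto_apply_of_ultraStarStrong {ι : Type*} {l : Filter ι} {b : ι → H →L[ℂ] H}
    {c : H →L[ℂ] H} (h : Tendsto b l (@nhds _ (ultraStarStrong H) c)) (x : H) :
    Tendsto (fun i => b i x) l (𝓝 (c x)) := by
  have h2 := (tendsto_ultraStarStrong_iff.mp h (lp.single 2 0 x)).1
  rw [tendsto_iff_norm_sub_tendsto_zero] at h2 ⊢
  refine squeeze_zero (fun _ => norm_nonneg _) (fun i => ?_) h2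
  have := lp.norm_apply_le_norm (p := 2) (by norm_num)
    (evalSeq (lp.single 2 0 x) (b i) - evalSeq (lp.single 2 0 x) c) 0
  refine le_trans (le_of_eq ?_) this
  have hx : (lp.single 2 0 x : lp (fun _ : ℕ => H) 2) 0 = x := by simp
  change _ = ‖b i ((lp.single 2 0 x : lp (fun _ : ℕ => H) 2) 0) -
    c ((lp.single 2 0 x : lp (fun _ : ℕ => H) 2) 0)‖
  rw [hx]

end UltraStarStrong

/-! ### Resolvents of self-adjoint operators -/

section Resolvent

variable {H : Type u} [NormedAddCommGroup H] [InnerProductSpace ℂ H] [CompleteSpace H]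

theorem mem_resolventSet_of_isSelfAdjoint {A : Type*} [CStarAlgebra A] {b : A}
    (hb : IsSelfAdjoint b) {z : ℂ} (hz : z.im ≠ 0) : z ∈ resolventSet ℂ b := by
  by_contra h
  exact hz (hb.im_eq_zero_of_mem_spectrum h)

theorem resolvent_mul_cancel {A : Type*} [Ring A] [Algebra ℂ A] {b : A} {z : ℂ}
    (hz : z ∈ resolventSet ℂ b) : resolvent b z * (algebraMap ℂ A z - b) = 1 :=
  Ring.inverse_mul_cancel _ hz

theorem mul_resolvent_cancel {A : Type*} [Ring A] [Algebra ℂ A] {b : A} {z : ℂ}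
    (hz : z ∈ resolventSet ℂ b) : (algebraMap ℂ A z - b) * resolvent b z = 1 :=
  Ring.mul_inverse_cancel _ hz

theorem star_resolvent {A : Type*} [Ring A] [StarRing A] [Algebra ℂ A] [StarModule ℂ A] (b : A)
    (z : ℂ) : star (resolvent b z) = resolvent (star b) (star z) := by
  rw [resolvent, resolvent, ← Ring.inverse_star, star_sub, algebraMap_star_comm]

/-- Applied to inclusions, it identifies resolvents computed in a subalgebra with those in `B(H)`.
The hypothesis on `z` excludes the default value `0` of `Ring.inverse` on the left. -/
theorem map_resolvent {A B : Type*} [Ring A] [Algebra ℂ A] [Ring B] [Algebra ℂ B]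
    (f : A →ₐ[ℂ] B) {b : A} {z : ℂ} (hz : z ∈ resolventSet ℂ b) :
    f (resolvent b z) = resolvent (f b) z := by
  have h1 : f (resolvent b z) * (algebraMap ℂ B z - f b) = 1 := by
    rw [← AlgHom.commutes f, ← map_sub, ← map_mul, resolvent_mul_cancel hz, map_one]
  have h2 : z ∈ resolventSet ℂ (f b) := AlgHom.mem_resolventSet_apply f hz
  rw [← mul_one (f _), ← mul_resolvent_cancel h2, ← mul_assoc, h1, one_mul]

/-- Since `⟪x, b x⟫` is real, `⟪x, (z - b) x⟫` has imaginary part `z.im * ‖x‖ ^ 2`; Cauchy–Schwarz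
concludes. -/
theorem norm_le_norm_sub_apply {b : H →L[ℂ] H} (hb : IsSelfAdjoint b) {z : ℂ} (hz : 1 ≤ |z.im|)
    (x : H) : ‖x‖ ≤ ‖(algebraMap ℂ (H →L[ℂ] H) z - b) x‖ := by
  rcases eq_or_ne x 0 with rfl | hx
  · simp
  have hx' : 0 < ‖x‖ := norm_pos_iff.mpr hx
  have him : (⟪x, b x⟫_ℂ).im = 0 := by
    have h : starRingEnd ℂ ⟪x, b x⟫_ℂ = ⟪x, b x⟫_ℂ := by
      rw [inner_conj_symm]
      exact hb.isSymmetric x x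
    exact Complex.conj_eq_iff_im.mp h
  have h1 : (⟪x, (algebraMap ℂ (H →L[ℂ] H) z - b) x⟫_ℂ).im = z.im * ‖x‖ ^ 2 := by
    have : (algebraMap ℂ (H →L[ℂ] H) z - b) x = z • x - b x := rfl
    rw [this, inner_sub_right, inner_smul_right, Complex.sub_im, him, inner_self_eq_norm_sq_to_K]
    simp [Complex.mul_im, ← Complex.ofReal_pow]
  have h2 := (Complex.abs_im_le_norm _).trans
    (norm_inner_le_norm (𝕜 := ℂ) x ((algebraMap ℂ (H →L[ℂ] H) z - b) x))
  rw [h1, abs_mul, abs_of_nonneg (sq_nonneg ‖x‖)] at h2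
  nlinarith [mul_le_mul_of_nonneg_right hz (sq_nonneg ‖x‖)]

theorem norm_resolvent_le_one {b : H →L[ℂ] H} (hb : IsSelfAdjoint b) {z : ℂ} (hz : 1 ≤ |z.im|) :
    ‖resolvent b z‖ ≤ 1 := by
  have hz' : z ∈ resolventSet ℂ b := mem_resolventSet_of_isSelfAdjoint hb fun h => by
    norm_num [h] at hz
  refine ContinuousLinearMap.opNorm_le_bound _ zero_le_one fun x => ?_
  refine (norm_le_norm_sub_apply hb hz _).trans_eq ?_
  rw [← mul_apply_eq_comp, mul_resolvent_cancel hz', one_mul]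
  rfl

/-- Strong convergence of self-adjoint operators implies strong resolvent convergence. -/
theorem tendsto_resolvent_apply {ι : Type*} {l : Filter ι} {b : ι → H →L[ℂ] H} {c : H →L[ℂ] H}
    (hb : ∀ i, IsSelfAdjoint (b i)) (hc : IsSelfAdjoint c)
    (h : ∀ x, Tendsto (fun i => b i x) l (𝓝 (c x))) {z : ℂ} (hz : 1 ≤ |z.im|) (x : H) :
    Tendsto (fun i => resolvent (b i) z x) l (𝓝 (resolvent c z x)) := by
  have hz0 : z.im ≠ 0 := fun h => by norm_num [h] at hz
  rw [tendsto_iff_norm_sub_tendsto_zero]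
  refine squeeze_zero (fun _ => norm_nonneg _) (fun i => ?_)
    (tendsto_iff_norm_sub_tendsto_zero.mp (h (resolvent c z x)))
  -- Second resolvent identity: as the left factor is a contraction, convergence is needed only at
  -- the fixed vector `resolvent c z x`.
  have h1 : resolvent (b i) z - resolvent c z = resolvent (b i) z * ((b i - c) * resolvent c z) := by
    have e1 := resolvent_mul_cancel (mem_resolventSet_of_isSelfAdjoint (hb i) hz0)
    have e2 := mul_resolvent_cancel (mem_resolventSet_of_isSelfAdjoint hc hz0)
    calc resolvent (b i) z - resolvent c z
        = resolvent (b i) z * ((algebraMap ℂ _ z - c) * resolvent c z)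
          - (resolvent (b i) z * (algebraMap ℂ _ z - b i)) * resolvent c z := by
          rw [e1, e2, mul_one, one_mul]
      _ = _ := by noncomm_ring
  have h2 : resolvent (b i) z x - resolvent c z x =
      resolvent (b i) z (b i (resolvent c z x) - c (resolvent c z x)) := by
    rw [← sub_apply, h1]
    rfl
  rw [h2]
  exact ((resolvent (b i) z).le_of_opNorm_le (norm_resolvent_le_one (hb i) hz) _).trans_eq
    (one_mul _)

end Resolvent

/-! ### The intertwining relation on the whole algebra -/

section Intertwining

variable {H : Type u} [NormedAddCommGroup H] [InnerProductSpace ℂ H] [CompleteSpace H]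
variable {K : Type v} [NormedAddCommGroup K] [InnerProductSpace ℂ K] [CompleteSpace K]

theorem isClosed_toStarSubalgebra (M : VonNeumannAlgebra H) :
    IsClosed (M.toStarSubalgebra : Set (H →L[ℂ] H)) := by
  have h := Set.isClosed_centralizer (Set.centralizer (M : Set (H →L[ℂ] H)))
  rwa [M.centralizer_centralizer] at h

theorem subset_of_isHyperfinite {M : VonNeumannAlgebra H} {𝓕 : Set (StarSubalgebra ℂ (H →L[ℂ] H))}
    (hM : ∀ x : H →L[ℂ] H, x ∈ M ↔ ContinuousLinearMapWOT.ofCLM x ∈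
      closure {y : H →WOT[ℂ] H | ∃ A ∈ 𝓕, y.toCLM ∈ A}) {A : StarSubalgebra ℂ (H →L[ℂ] H)}
    (hA : A ∈ 𝓕) : A ≤ M.toStarSubalgebra :=
  fun x hx => (hM x).mpr (subset_closure ⟨A, hA, hx⟩)

/-- A bounded homomorphism of `M` is `*`-preserving on the union of a directed family of
finite-dimensional `*`-subalgebras, for an equivalent inner product. -/
theorem exists_form_of_directed {M : VonNeumannAlgebra H}
    {𝓕 : Set (StarSubalgebra ℂ (H →L[ℂ] H))} (hne : 𝓕.Nonempty) (hdir : DirectedOn (· ≤ ·) 𝓕)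
    (hfin : ∀ A ∈ 𝓕, FiniteDimensional ℂ A) (hle : ∀ A ∈ 𝓕, A ≤ M.toStarSubalgebra)
    (ρ : M.toStarSubalgebra →A[ℂ] (K →L[ℂ] K)) :
    ∃ T : K →L[ℂ] K, IsEquivalentForm ‖ρ.toContinuousLinearMap‖ T ∧
      ∀ a : M.toStarSubalgebra, (∃ A ∈ 𝓕, (a : H →L[ℂ] H) ∈ A) →
        ∀ x y, ⟪T x, ρ a y⟫_ℂ = ⟪T (ρ (star a) x), y⟫_ℂ := by
  have hloc : ∀ A : 𝓕, ∃ T : K →L[ℂ] K, IsEquivalentForm ‖ρ.toContinuousLinearMap‖ T ∧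
      ∀ a : M.toStarSubalgebra, (a : H →L[ℂ] H) ∈ A.1 →
        ∀ x y, ⟪T x, ρ a y⟫_ℂ = ⟪T (ρ (star a) x), y⟫_ℂ := by
    rintro ⟨A, hA⟩
    have := hfin A hA
    have : IsClosed (A : Set (H →L[ℂ] H)) :=
      Submodule.closed_of_finiteDimensional (Subalgebra.toSubmodule A.toSubalgebra)
    obtain ⟨T, hT, h⟩ := exists_form_of_finiteDimensional A
      ((ρ : M.toStarSubalgebra →ₐ[ℂ] (K →L[ℂ] K)).comp
        (StarSubalgebra.inclusion (hle A hA) : A →ₐ[ℂ] M.toStarSubalgebra))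
      (norm_nonneg ρ.toContinuousLinearMap)
      (fun a => ρ.toContinuousLinearMap.le_opNorm (StarSubalgebra.inclusion (hle A hA) a))
    exact ⟨T, hT, fun a ha => h ⟨a, ha⟩⟩
  choose T hT hTi using hloc
  have : Nonempty 𝓕 := hne.to_subtype
  have : IsDirectedOrder 𝓕 := ⟨directedOn_iff_directed.mp hdir⟩
  -- The ultrafilter refines `atTop`, so a relation valid for all sufficiently large subalgebras
  -- survives in the limit.
  obtain ⟨S, hS, hlim⟩ := exists_weak_limit (Ultrafilter.of (atTop : Filter 𝓕)) T
    (fun A => (hT A).norm_le)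
  refine ⟨S, ⟨fun x y => ?_, fun x => ?_, hS⟩, fun a ha x y => ?_⟩
  · refine tendsto_nhds_unique (hlim x y) ?_
    have h := (Complex.continuous_conj.tendsto _).comp (hlim y x)
    rw [inner_conj_symm] at h
    refine h.congr fun A => ?_
    simp only [Function.comp, inner_conj_symm, (hT A).symm]
  · exact ge_of_tendsto (((Complex.continuous_re.tendsto _).comp (hlim x x)).const_mul _)
      (.of_forall fun A => (hT A).lower x)
  · obtain ⟨A, hA, haA⟩ := ha
    refine tendsto_nhds_unique_of_eventuallyEq (hlim x (ρ a y)) (hlim (ρ (star a) x) y) ?_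
    refine Filter.Eventually.filter_mono (Ultrafilter.of_le _) ?_
    filter_upwards [eventually_ge_atTop (⟨A, hA⟩ : 𝓕)] with B hB
    exact hTi B a (hB haA) x y

theorem IsUltraStarStrongContinuousOnBall.tendsto_apply {M : VonNeumannAlgebra H}
    {f : M.toStarSubalgebra → (K →L[ℂ] K)} (hf : IsUltraStarStrongContinuousOnBall M f)
    {ι : Type*} {l : Filter ι} {b : ι → M.toStarSubalgebra} {c : M.toStarSubalgebra}
    (hb : ∀ i, ‖(b i : H →L[ℂ] H)‖ ≤ 1) (hc : ‖(c : H →L[ℂ] H)‖ ≤ 1)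
    (h : ∀ x, Tendsto (fun i => (b i : H →L[ℂ] H) x) l (𝓝 ((c : H →L[ℂ] H) x)))
    (h' : ∀ x, Tendsto (fun i => star (b i : H →L[ℂ] H) x) l (𝓝 (star (c : H →L[ℂ] H) x)))
    (x : K) : Tendsto (fun i => f (b i) x) l (𝓝 (f c x)) := by
  have hmem : ∀ {a : M.toStarSubalgebra}, ‖(a : H →L[ℂ] H)‖ ≤ 1 → a ∈ Metric.closedBall 0 1 :=
    fun ha => mem_closedBall_zero_iff.mpr ha
  have hnhds := @nhds_induced _ _ (ultraStarStrong H)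
    (Subtype.val : M.toStarSubalgebra → H →L[ℂ] H) c
  have h1 : Tendsto b l (@nhdsWithin _ ((ultraStarStrong H).induced Subtype.val) c
      (Metric.closedBall 0 1)) := by
    refine tendsto_inf.mpr ⟨?_, tendsto_principal.mpr (.of_forall fun i => hmem (hb i))⟩
    rw [hnhds]
    exact tendsto_comap_iff.mpr (tendsto_ultraStarStrong hb hc h h')
  exact tendsto_apply_of_ultraStarStrong (Tendsto.comp (hf c (hmem hc)) h1) x

/-- On a hyperfinite algebra, a homomorphism which is continuous on the unit ball is
`*`-preserving for an equivalent inner product. -/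
theorem exists_form_of_isHyperfinite {M : VonNeumannAlgebra H} (hM : IsHyperfinite M)
    (ρ : M.toStarSubalgebra →A[ℂ] (K →L[ℂ] K)) (hρ : IsUltraStarStrongContinuousOnBall M ρ) :
    ∃ T : K →L[ℂ] K, IsEquivalentForm ‖ρ.toContinuousLinearMap‖ T ∧
      ∀ a : M.toStarSubalgebra, star (ρ a) * T = T * ρ (star a) := by
  obtain ⟨𝓕, hne, hdir, hfin, hM⟩ := hM
  have hle : ∀ A ∈ 𝓕, A ≤ M.toStarSubalgebra := fun A hA => subset_of_isHyperfinite hM hA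
  obtain ⟨T, hT, hTi⟩ := exists_form_of_directed hne hdir hfin hle ρ
  have hclosed := isClosed_toStarSubalgebra M
  have hstar : ∀ a : M.toStarSubalgebra, (∀ x y, ⟪T x, ρ a y⟫_ℂ = ⟪T (ρ (star a) x), y⟫_ℂ) →
      star (ρ a) * T = T * ρ (star a) := by
    intro a h
    ext x
    refine ext_inner_right ℂ fun y => ?_
    rw [mul_apply_eq_comp, mul_apply_eq_comp, ContinuousLinearMap.star_eq_adjoint,
      ContinuousLinearMap.adjoint_inner_left]
    exact h x y
  refine ⟨T, hT, ?_⟩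
  let V : Submodule ℂ (H →L[ℂ] H) :=
    { carrier := {b | ∃ A ∈ 𝓕, b ∈ A}
      zero_mem' := by obtain ⟨A, hA⟩ := hne; exact ⟨A, hA, zero_mem A⟩
      add_mem' := by
        rintro a b ⟨A, hA, ha⟩ ⟨B, hB, hb⟩
        obtain ⟨D, hD, hAD, hBD⟩ := hdir A hA B hB
        exact ⟨D, hD, add_mem (hAD ha) (hBD hb)⟩
      smul_mem' := by
        rintro c a ⟨A, hA, ha⟩
        exact ⟨A, hA, A.smul_mem ha c⟩ }
  have hres : ∀ c : M.toStarSubalgebra, IsSelfAdjoint c →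
      star (ρ (resolvent c Complex.I)) * T = T * ρ (star (resolvent c Complex.I)) := by
    intro c hc
    have hcs : IsSelfAdjoint (c : H →L[ℂ] H) := congrArg Subtype.val hc
    obtain ⟨l, hl, hlim⟩ := exists_filter_tendsto_of_isSelfAdjoint V
      (fun b ⟨A, hA, hb⟩ => ⟨A, hA, star_mem hb⟩) hcs ((hM c).mp c.2)
    have hVM : ∀ b ∈ V, b ∈ M.toStarSubalgebra := fun b ⟨A, hA, hb⟩ => hle A hA hb
    let β : {b : H →L[ℂ] H // b ∈ V ∧ IsSelfAdjoint b} → M.toStarSubalgebra :=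
      fun b => ⟨b.1, hVM b.1 b.2.1⟩
    have hβ : ∀ b, IsSelfAdjoint (β b) := fun b => Subtype.ext b.2.2
    have hval : ∀ {z : ℂ}, z.im ≠ 0 → ∀ a : M.toStarSubalgebra, IsSelfAdjoint a →
        ((resolvent a z : M.toStarSubalgebra) : H →L[ℂ] H) = resolvent (a : H →L[ℂ] H) z :=
      fun hz a ha => map_resolvent M.toStarSubalgebra.subtype.toAlgHom
        (mem_resolventSet_of_isSelfAdjoint ha hz)
    -- Both `i` and `-i` are needed, since the adjoint exchanges the two resolvents.
    have hconv : ∀ {z : ℂ}, |z.im| = 1 → ∀ x,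
        Tendsto (fun b => ρ (resolvent (β b) z) x) l (𝓝 (ρ (resolvent c z) x)) := by
      intro z hz
      have hz0 : ∀ w : ℂ, |w.im| = 1 → w.im ≠ 0 := fun w hw h => by norm_num [h] at hw
      have hz' : |(star z).im| = 1 := by simpa using hz
      refine hρ.tendsto_apply (fun b => ?_) ?_ (fun x => ?_) (fun x => ?_)
      · rw [hval (hz0 z hz) _ (hβ b)]
        exact norm_resolvent_le_one b.2.2 hz.ge
      · rw [hval (hz0 z hz) _ hc]
        exact norm_resolvent_le_one hcs hz.ge
      · simp only [hval (hz0 z hz) _ (hβ _), hval (hz0 z hz) _ hc]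
        exact tendsto_resolvent_apply (fun b => b.2.2) hcs hlim hz.ge x
      · simp only [hval (hz0 z hz) _ (hβ _), hval (hz0 z hz) _ hc, star_resolvent, hcs.star_eq]
        refine (tendsto_resolvent_apply (fun b => b.2.2) hcs hlim hz'.ge x).congr fun b => ?_
        change _ = resolvent (star b.1) (star z) x
        rw [b.2.2.star_eq]
    apply hstar
    intro x y
    have hI : |Complex.I.im| = 1 := by simp
    have hI' : |(star Complex.I).im| = 1 := by simp
    rw [star_resolvent, hc.star_eq]
    refine tendsto_nhds_unique ((tendsto_const_nhds (x := T x)).inner (𝕜 := ℂ) (hconv hI y)) ?_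
    refine Tendsto.congr (fun b => ?_)
      (((T.continuous.tendsto _).comp (hconv hI' x)).inner (tendsto_const_nhds (x := y)))
    obtain ⟨A, hA, hbA⟩ := b.2.1
    have := hfin A hA
    have : IsClosed (A : Set (H →L[ℂ] H)) :=
      Submodule.closed_of_finiteDimensional (Subalgebra.toSubmodule A.toSubalgebra)
    -- The inverse of `i - b` already exists inside the finite-dimensional `A`, by reality of the
    -- spectrum there.
    have hmem : ((resolvent (β b) Complex.I : M.toStarSubalgebra) : H →L[ℂ] H) ∈ A := by
      have hbs : IsSelfAdjoint (⟨b.1, hbA⟩ : A) := Subtype.ext b.2.2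
      rw [hval (by simp) _ (hβ b)]
      have h := map_resolvent A.subtype.toAlgHom
        (mem_resolventSet_of_isSelfAdjoint hbs (z := Complex.I) (by simp))
      change _ = resolvent b.1 Complex.I at h
      exact h ▸ Subtype.property _
    rw [hTi _ ⟨A, hA, hmem⟩ x y, star_resolvent, (hβ b).star_eq]
    rfl
  let W : Submodule ℂ M.toStarSubalgebra :=
    { carrier := {a | star (ρ a) * T = T * ρ (star a)}
      zero_mem' := by simp
      add_mem' := by
        intro a b ha hb
        simp only [Set.mem_ofPred_eq] at ha hb ⊢
        rw [map_add, star_add, add_mul, star_add, map_add, mul_add, ha, hb]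
      smul_mem' := by
        intro c a ha
        simp only [Set.mem_ofPred_eq] at ha ⊢
        rw [map_smul, star_smul, smul_mul_assoc, star_smul, map_smul, mul_smul_comm, ha] }
  have hsa : ∀ c : M.toStarSubalgebra, IsSelfAdjoint c → c ∈ W := by
    intro c hc
    have hz := mem_resolventSet_of_isSelfAdjoint hc (z := Complex.I) (by simp)
    have hone : (1 : M.toStarSubalgebra) ∈ W := by
      change star (ρ 1) * T = T * ρ (star 1)
      simp
    -- The relation passes to inverses: multiply the one for `R` by `star (ρ q)` on the left and `ρ
    -- (star q)` on the right.
    have hq : algebraMap ℂ M.toStarSubalgebra Complex.I - c ∈ W := by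
      set q := algebraMap ℂ M.toStarSubalgebra Complex.I - c
      set R := resolvent c Complex.I
      have h1 : star (ρ q) * star (ρ R) = 1 := by
        rw [← star_mul, ← map_mul, resolvent_mul_cancel hz, map_one, star_one]
      have h2 : ρ (star R) * ρ (star q) = 1 := by
        rw [← map_mul, ← star_mul, mul_resolvent_cancel hz, star_one, map_one]
      calc star (ρ q) * T = star (ρ q) * (T * ρ (star R)) * ρ (star q) := by
            rw [mul_assoc, mul_assoc T, h2, mul_one]
        _ = star (ρ q) * star (ρ R) * T * ρ (star q) := by rw [← hres c hc]; simp only [mul_assoc, R]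
        _ = T * ρ (star q) := by rw [h1, one_mul]
    have hcq : c = Complex.I • (1 : M.toStarSubalgebra) -
        (algebraMap ℂ M.toStarSubalgebra Complex.I - c) := by
      rw [Algebra.algebraMap_eq_smul_one, sub_sub_cancel]
    rw [hcq]
    exact W.sub_mem (W.smul_mem _ hone) hq
  intro a
  have ha : a ∈ W := by
    rw [← realPart_add_I_smul_imaginaryPart a]
    exact W.add_mem (hsa _ (realPart a).2) (W.smul_mem _ (hsa _ (imaginaryPart a).2))
  exact ha

end Intertwining

/-! ### Norm estimates for matrices over C⋆-algebras -/

section Matrix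

/-- Entrywise application of a `*`-homomorphism to matrices is contractive, also when the norm of
the matrix is computed in an ambient C⋆-algebra. -/
theorem norm_map_le_norm_map_of_injective {n A B D : Type*} [Fintype n] [CStarAlgebra A]
    [CStarAlgebra B] [PartialOrder B] [StarOrderedRing B]
    [CStarAlgebra D] [PartialOrder D] [StarOrderedRing D]
    (π : A →⋆ₐ[ℂ] D) (j : A →⋆ₐ[ℂ] B) (hj : Function.Injective j) (a : CStarMatrix n n A) :
    ‖(a.map π : CStarMatrix n n D)‖ ≤ ‖(a.map j : CStarMatrix n n B)‖ := by
  let _ := CStarAlgebra.spectralOrder A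
  have := CStarAlgebra.spectralOrderedRing A
  -- The amplification of `j` is injective, hence isometric; that of `π` is contractive.
  have h1 := NonUnitalStarAlgHom.norm_map
    (CStarMatrix.mapₙₐ (n := n) (j : A →⋆ₙₐ[ℂ] B)) (CStarMatrix.map_injective hj) a
  have h2 := NonUnitalStarAlgHom.norm_apply_le
    (CStarMatrix.mapₙₐ (n := n) (π : A →⋆ₙₐ[ℂ] D)) a
  exact h2.trans_eq h1.symm

/-- The diagonal embedding of a C⋆-algebra into matrices is contractive. -/
theorem norm_diagonal_le {n B : Type*} [Fintype n] [DecidableEq n]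
    [CStarAlgebra B] [PartialOrder B] [StarOrderedRing B] (x : B) :
    ‖(CStarMatrix.ofMatrix (Matrix.diagonal fun _ : n => x) : CStarMatrix n n B)‖ ≤ ‖x‖ := by
  let δ : B →⋆ₙₐ[ℂ] CStarMatrix n n B :=
    { toFun := fun x => CStarMatrix.ofMatrix (Matrix.diagonal fun _ : n => x)
      map_smul' := fun c x => by ext i k; by_cases h : i = k <;> simp [h]
      map_zero' := by ext i k; simp
      map_add' := fun x y => by ext i k; by_cases h : i = k <;> simp [h]
      map_mul' := fun x y => by
        ext i k
        simp [CStarMatrix.mul_apply, Matrix.diagonal_apply]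
      map_star' := fun x => by
        ext i k
        rcases eq_or_ne i k with h | h
        · simp [CStarMatrix.star_apply, h]
        · simp [CStarMatrix.star_apply, h, h.symm] }
  exact NonUnitalStarAlgHom.norm_apply_le δ x

/-- Entrywise multiplication by `s` and `t` is multiplication by constant diagonal matrices, so its
cost is independent of the matrix size. -/
theorem norm_map_conj_le {n A B : Type*} [Fintype n] [CStarAlgebra B] [PartialOrder B]
    [StarOrderedRing B] (f g : A → B) (s t : B) (h : ∀ a, f a = s * g a * t)
    (a : CStarMatrix n n A) :
    ‖(a.map f : CStarMatrix n n B)‖ ≤ ‖s‖ * ‖(a.map g : CStarMatrix n n B)‖ * ‖t‖ := by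
  classical
  have : a.map f = CStarMatrix.ofMatrix (Matrix.diagonal fun _ : n => s) * a.map g *
      CStarMatrix.ofMatrix (Matrix.diagonal fun _ : n => t) := by
    ext i k
    simp [CStarMatrix.mul_apply, Matrix.diagonal_apply, h]
  rw [this]
  refine (norm_mul_le _ _).trans ?_
  gcongr
  · refine (norm_mul_le _ _).trans ?_
    gcongr
    exact norm_diagonal_le s
  · exact norm_diagonal_le t

end Matrix

/-! ### Similarity to a `*`-homomorphism -/

section Similarity

variable {K : Type v} [NormedAddCommGroup K] [InnerProductSpace ℂ K] [CompleteSpace K]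

/-- For the positive root `S` of `T`, `‖S‖² = ‖T‖`, and the lower bound on the form reads `‖x‖ ≤ C
‖S x‖`, which bounds the inverse. -/
theorem IsEquivalentForm.exists_sqrt {C : ℝ} (hC : 0 ≤ C) {T : K →L[ℂ] K}
    (hT : IsEquivalentForm C T) :
    ∃ S S' : K →L[ℂ] K, S * S' = 1 ∧ S' * S = 1 ∧ S * S = T ∧ IsSelfAdjoint S ∧
      ‖S‖ ≤ C ∧ ‖S'‖ ≤ C := by
  have hpos : ∀ x, 0 ≤ RCLike.re ⟪T x, x⟫_ℂ := by
    intro x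
    by_contra! h
    have h1 := hT.lower x
    have h2 : ‖x‖ = 0 := by
      rw [← sq_eq_zero_iff]
      exact le_antisymm (h1.trans (mul_nonpos_of_nonneg_of_nonpos (sq_nonneg C) h.le)) (sq_nonneg _)
    rw [norm_eq_zero] at h2
    simp [h2] at h
  have hT0 : 0 ≤ T := by
    rw [ContinuousLinearMap.nonneg_iff_isPositive]
    exact ⟨hT.symm, hpos⟩
  have hunit : IsUnit T := by
    refine ContinuousLinearMap.isUnit_of_forall_le_norm_inner_map T
      -- Adding `1` keeps the constant positive when `C = 0`, which can occur if `K` is trivial.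
      (c := (C.toNNReal ^ 2 + 1)⁻¹) (by positivity) fun x => ?_
    refine le_trans ?_ (RCLike.re_le_norm _)
    have h1 := hT.lower x
    have h2 := hpos x
    push_cast [Real.coe_toNNReal C hC]
    rw [mul_inv_le_iff₀ (by positivity)]
    nlinarith
  have hS : CFC.sqrt T * CFC.sqrt T = T := CFC.sqrt_mul_sqrt_self T
  have hSs : IsSelfAdjoint (CFC.sqrt T) := (CFC.sqrt_nonneg T).isSelfAdjoint
  obtain ⟨u, hu⟩ : IsUnit (CFC.sqrt T) := CFC.isUnit_sqrt_iff T |>.mpr hunit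
  have hnorm : ∀ x, ‖x‖ ≤ C * ‖CFC.sqrt T x‖ := by
    intro x
    refine le_of_sq_le_sq ?_ (by positivity)
    refine (hT.lower x).trans_eq ?_
    have h : ⟪CFC.sqrt T (CFC.sqrt T x), x⟫_ℂ = ⟪CFC.sqrt T x, CFC.sqrt T x⟫_ℂ :=
      hSs.isSymmetric _ _
    rw [mul_pow, ← inner_self_eq_norm_sq (𝕜 := ℂ), ← h, ← mul_apply_eq_comp, hS]
  refine ⟨CFC.sqrt T, ((u⁻¹ : (K →L[ℂ] K)ˣ) : K →L[ℂ] K), ?_, ?_, hS, hSs, ?_, ?_⟩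
  · rw [← hu, Units.mul_inv]
  · rw [← hu, Units.inv_mul]
  · refine le_of_sq_le_sq ?_ hC
    rw [sq, ← CStarRing.norm_star_mul_self, hSs.star_eq, hS]
    exact hT.norm_le
  · refine ContinuousLinearMap.opNorm_le_bound _ hC fun x => ?_
    refine (hnorm _).trans_eq ?_
    rw [← mul_apply_eq_comp, ← hu, Units.mul_inv]
    rfl

/-- A homomorphism which is `*`-preserving for an equivalent inner product is similar to a
`*`-homomorphism. -/
theorem IsEquivalentForm.norm_map_le {n A B : Type*} [Fintype n] [CStarAlgebra A]
    [CStarAlgebra B] [PartialOrder B] [StarOrderedRing B]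
    {C : ℝ} (hC : 0 ≤ C) {T : K →L[ℂ] K} (hT : IsEquivalentForm C T) (ρ : A →ₐ[ℂ] (K →L[ℂ] K))
    (hρ : ∀ a, star (ρ a) * T = T * ρ (star a))
    (j : A →⋆ₐ[ℂ] B) (hj : Function.Injective j) (a : CStarMatrix n n A) :
    ‖(a.map ρ : CStarMatrix n n (K →L[ℂ] K))‖ ≤ C ^ 2 * ‖(a.map j : CStarMatrix n n B)‖ := by
  obtain ⟨S, S', h1, h2, hS, hSs, hSC, hSC'⟩ := hT.exists_sqrt hC
  have hS's : star S' = S' := by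
    calc star S' = star S' * (S * S') := by rw [h1, mul_one]
      _ = star (S * S') * S' := by rw [star_mul, hSs.star_eq, mul_assoc]
      _ = S' := by rw [h1, star_one, one_mul]
  let π : A →⋆ₐ[ℂ] (K →L[ℂ] K) :=
    { toFun := fun a => S * ρ a * S'
      map_one' := by simp [h1]
      map_mul' := fun a b => by
        rw [map_mul]
        calc S * (ρ a * ρ b) * S' = S * ρ a * 1 * ρ b * S' := by noncomm_ring
          _ = _ := by rw [← h2]; noncomm_ring
      map_zero' := by simp
      map_add' := fun a b => by rw [map_add]; noncomm_ring
      commutes' := fun r => by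
        rw [AlgHom.commutes, ← Algebra.commutes, mul_assoc, h1, mul_one]
      -- With `S² = T`, intertwining gives `S'(S² ρ(a*))S' = S' ρ(a)* S² S' = S' ρ(a)* S`.
      map_star' := fun a => by
        rw [star_mul, star_mul, hS's, hSs.star_eq]
        calc S * ρ (star a) * S' = S' * (S * S * ρ (star a)) * S' := by
              rw [mul_assoc S S, ← mul_assoc S' S, h2, one_mul]
          _ = S' * (star (ρ a) * S) * (S * S') := by rw [hS, ← hρ, ← hS]; noncomm_ring
          _ = _ := by rw [h1, mul_one] }
  have h := norm_map_conj_le (n := n) ρ π S' S (fun a => by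
    change ρ a = S' * (S * ρ a * S') * S
    calc ρ a = 1 * ρ a * 1 := by simp
      _ = _ := by rw [← h2]; noncomm_ring) a
  calc _ ≤ ‖S'‖ * ‖(a.map π : CStarMatrix n n (K →L[ℂ] K))‖ * ‖S‖ := h
    _ ≤ C * ‖(a.map j : CStarMatrix n n B)‖ * C := by
      gcongr
      exact norm_map_le_norm_map_of_injective π j hj a
    _ = _ := by ring

end Similarity

/-! ### The degree bound -/

section DegreeBound

variable {H : Type u} [NormedAddCommGroup H] [InnerProductSpace ℂ H] [CompleteSpace H]
variable {K : Type v} [NormedAddCommGroup K] [InnerProductSpace ℂ K] [CompleteSpace K]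

theorem cbNorm_le_sq {M : VonNeumannAlgebra H} (hM : IsHyperfinite M)
    (ρ : M.toStarSubalgebra →A[ℂ] (K →L[ℂ] K)) (hρ : IsUltraStarStrongContinuousOnBall M ρ) :
    cbNorm M ρ ≤ ‖ρ.toContinuousLinearMap‖ₑ ^ 2 := by
  have := isClosed_toStarSubalgebra M
  obtain ⟨T, hT, hi⟩ := exists_form_of_isHyperfinite hM ρ hρ
  refine iSup_le fun n => iSup_le fun a => iSup_le fun ha => ?_
  have h := hT.norm_map_le (norm_nonneg _) (ρ : M.toStarSubalgebra →ₐ[ℂ] (K →L[ℂ] K)) hi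
    M.toStarSubalgebra.subtype Subtype.val_injective a
  have h' : ‖(a.map ρ : CStarMatrix (Fin n) (Fin n) (K →L[ℂ] K))‖ ≤
      ‖ρ.toContinuousLinearMap‖ ^ 2 :=
    h.trans (mul_le_of_le_one_right (sq_nonneg _) ha)
  rw [← enorm_norm, ← enorm_norm ρ.toContinuousLinearMap, ← enorm_pow]
  rw [Real.enorm_of_nonneg (norm_nonneg _), Real.enorm_of_nonneg (by positivity)]
  exact ENNReal.ofReal_le_ofReal h'

theorem isDegreeBound_two {M : VonNeumannAlgebra H} (hM : IsHyperfinite M) :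
    IsDegreeBound.{u, v} M 2 := by
  intro K _ _ _ ρ hρ
  refine (cbNorm_le_sq hM ρ hρ).trans ?_
  -- The exponent dictates the choice `γ = 2`; the factor `2` is slack, as `1` suffices.
  have h : (1 : ℝ≥0∞) ≤ ((2 : ℝ≥0) : ℝ≥0∞) := by norm_num
  calc _ = 1 * ‖ρ.toContinuousLinearMap‖ₑ ^ ((2 : ℝ≥0) : ℝ) := by
        rw [one_mul, NNReal.coe_ofNat, ENNReal.rpow_two]
    _ ≤ _ := by gcongr

end DegreeBound

end HyperfiniteDegree
end

universe u v

theorem corollary5 {H : Type u} [NormedAddCommGroup H] [InnerProductSpace ℂ H] [CompleteSpace H]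
    (M : VonNeumannAlgebra H) (hM : HyperfiniteDegree.IsHyperfinite M) :
    HyperfiniteDegree.modifiedSimilarityDegree.{u, v} M ≤ 2 := by
  refine (iInf₂_le (2 : ℝ≥0) ⟨two_pos, HyperfiniteDegree.isDegreeBound_two hM⟩).trans_eq ?_
  norm_num
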